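/- Let $v\in C^2(\mathbb R)$ be such that $d\mu(x)=e^{-v(x)}\,dx$ is a probability measure on $\mathbb R$, let $N\ge 0$ be an integer, and let $\mu^{N+1}=\mu\otimes\cdots\otimes\mu$ be the product measure on $\mathbb R^{N+1}$. Then there exists at least one $t\in\mathbb R$ such that the coordinate half-space $H_t=\{x\in\mathbb R^{N+1}: x_{N+1}\le t\}$ is stable for $\mu^{N+1}$. Here, for a probability measure $f(x)\,dx=e^{\psi(x)}\,dx$ on $\mathbb R^{N+1}$ with $\psi\in C^2(\mathbb R^{N+1})$, a set $A\subseteq\mathbb R^{N+1}$ with $C^2$ boundary, outer unit normal $\nu$ and area element $da$ on $\partial A$, the set $A$ is called stable if the following two conditions hold. (1) Stationarity: the generalized mean curvature $N\mathcal H-\langle D\psi,\nu\rangle$ is constant on $\partial A$, where $N\mathcal H$ is the sum of the principal curvatures of $\partial A$, i.e. the trace of the shape operator $-d\nu$. (2) For every $u\in C^\infty_0(\partial A)$ (smooth with compact support) with $\int_{\partial A}u\,f\,da=0$, $$\int_{\partial A} f\,\big(|D_{\partial A}u|^2-K^2u^2\big)\,da+\int_{\partial A} f\,u^2\,\langle D^2\psi\,\nu,\nu\rangle\,da\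 \ge\ 0,$$ where $D_{\partial A}u$ is the tangential gradient and $K^2$ is the sum of the squares of the principal curvatures of $\partial A$. -/

import Mathlib

open MeasureTheory
open scoped ContDiff

noncomputable section

namespace HalfSpaceStability

/-- Euclidean space of dimension `d`. -/
abbrev E (d : ℕ) : Type := EuclideanSpace ℝ (Fin d)

/-- The `d`-fold product `μ ⊗ ⋯ ⊗ μ` as a measure on Euclidean space. -/
def productMeasure (μ : Measure ℝ) (d : ℕ) : Measure (E d) :=
  (Measure.pi fun _ : Fin d => μ).map (WithLp.toLp 2)

/-- `m` has the density `e^ψ` with respect to Lebesgue measure, and `ψ` is of class `C²`. -/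
def HasLogDensity {d : ℕ} (m : Measure (E d)) (ψ : E d → ℝ) : Prop :=
  ContDiff ℝ 2 ψ ∧ m = volume.withDensity fun x => ENNReal.ofReal (Real.exp (ψ x))

/-- `ρ` is a `C²` defining function of `A`: its gradient does not vanish on the boundary of `A`,
which is the zero set of `ρ`, and the interior of `A` is `{ρ < 0}`. A set that has such a function
is a set with `C²` boundary, lying locally on one side of it. The set itself may be open or closed,
since all the notions below depend on the boundary and on its outer normal only. -/
structure IsDefiningFunction {d : ℕ} (ρ : E d → ℝ) (A : Set (E d)) : Prop where
  contDiff : ContDiff ℝ 2 ρ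
  interior_eq : interior A = {x | ρ x < 0}
  frontier_eq : frontier A = {x | ρ x = 0}
  gradient_ne_zero : ∀ x ∈ frontier A, gradient ρ x ≠ 0

/-- The unit normal of the level sets of `ρ`. On the boundary of a set with defining function `ρ`
it is the outer unit normal `ν`. -/
def unitNormal {d : ℕ} (ρ : E d → ℝ) (x : E d) : E d :=
  ‖gradient ρ x‖⁻¹ • gradient ρ x

/-- The orthogonal projection of the whole space onto the tangent space `ν(x)ᗮ`. -/
def tangentProj {d : ℕ} (ρ : E d → ℝ) (x : E d) : E d →L[ℝ] E d :=
  (Submodule.span ℝ {unitNormal ρ x})ᗮ.starProjection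

/-- The shape operator `-dν` of the boundary with respect to the unit normal `ν`, a symmetric
operator of the tangent space, extended by `0` to the normal direction. Its eigenvalues on the
tangent space are the principal curvatures. -/
def shapeOperator {d : ℕ} (ρ : E d → ℝ) (x : E d) : E d →L[ℝ] E d :=
  -((tangentProj ρ x).comp ((fderiv ℝ (unitNormal ρ) x).comp (tangentProj ρ x)))

/-- The sum of the principal curvatures, that is, `d - 1` times the mean curvature. -/
def sumCurv {d : ℕ} (ρ : E d → ℝ) (x : E d) : ℝ :=
  LinearMap.trace ℝ (E d) (shapeOperator ρ x).toLinearMap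

/-- `K²`, the sum of the squares of the principal curvatures. -/
def sumSqCurv {d : ℕ} (ρ : E d → ℝ) (x : E d) : ℝ :=
  LinearMap.trace ℝ (E d) ((shapeOperator ρ x).comp (shapeOperator ρ x)).toLinearMap

/-- The tangential gradient along the boundary of (the restriction of) `u`. -/
def tangentialGradient {d : ℕ} (ρ u : E d → ℝ) (x : E d) : E d :=
  tangentProj ρ x (gradient u x)

/-- The generalized mean curvature `N H - ⟨Dψ, ν⟩`. -/
def genMeanCurv {d : ℕ} (ψ ρ : E d → ℝ) (x : E d) : ℝ :=
  sumCurv ρ x - inner ℝ (gradient ψ x) (unitNormal ρ x)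

/-- The integral over the boundary of `A ⊆ ℝ^(N+1)` against the area element. -/
def boundaryIntegral {N : ℕ} (A : Set (E (N + 1))) (g : E (N + 1) → ℝ) : ℝ :=
  ∫ x in frontier A, g x ∂μHE[N]

/-- The quadratic form
`∫ f (|D_∂A u|² - K² u²) da + ∫ f u² ⟨D²ψ ν, ν⟩ da` over the boundary of `A`, where `f = e^ψ`. -/
def indexForm {N : ℕ} (ψ ρ : E (N + 1) → ℝ) (A : Set (E (N + 1))) (u : E (N + 1) → ℝ) : ℝ :=
  boundaryIntegral A (fun x =>
      Real.exp (ψ x) * (‖tangentialGradient ρ u x‖ ^ 2 - sumSqCurv ρ x * u x ^ 2)) +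
    boundaryIntegral A (fun x =>
      Real.exp (ψ x) * u x ^ 2 * fderiv ℝ (fderiv ℝ ψ) x (unitNormal ρ x) (unitNormal ρ x))

/-- Stationarity for the density `e^ψ` of a set with defining function `ρ`: the generalized mean
curvature is constant on the boundary. -/
def IsStationaryWith {d : ℕ} (ψ ρ : E d → ℝ) (A : Set (E d)) : Prop :=
  ∃ c : ℝ, ∀ x ∈ frontier A, genMeanCurv ψ ρ x = c

/-- `A` is stable for the measure `m = e^ψ dx`: it has a `C²` boundary, it is stationary, and the
index form is nonnegative on all smooth compactly supported functions whose weighted mean over the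
boundary is zero. The function `ψ` is determined by `m`, and the normal and the curvatures on the
boundary do not depend on the choice of `ρ`. -/
def IsStable {N : ℕ} (m : Measure (E (N + 1))) (A : Set (E (N + 1))) : Prop :=
  ∃ ψ ρ : E (N + 1) → ℝ, HasLogDensity m ψ ∧ IsDefiningFunction ρ A ∧
    IsStationaryWith ψ ρ A ∧
    ∀ u : E (N + 1) → ℝ, ContDiff ℝ ∞ u → HasCompactSupport u →
      boundaryIntegral A (fun x => u x * Real.exp (ψ x)) = 0 →
      0 ≤ indexForm ψ ρ A u

/-- The coordinate half-space `{x_(N+1) ≤ t}` of `ℝ^(N+1)`. -/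
def coordHalfSpace (N : ℕ) (t : ℝ) : Set (E (N + 1)) :=
  {x | x (Fin.last N) ≤ t}

end HalfSpaceStability

end

/-!
The boundary of `coordHalfSpace N t` is flat and isometric to `ℝ^N`, its weight there is
`e^(-v t)` times the density of `μ^N`, and the second derivative of the log-density in the normal
direction is `-v'' t`. Stability therefore follows from the Poincaré inequality for `μ^N` with
constant `v'' t`, and by tensorization (the Efron–Stein inequality) from that for `μ` itself.

On the line, let `w` have mean zero and let `F' = w e^(-v)` with `F` vanishing at both ends.
The bound `L ∫ F² e^v ≤ ∫ F'² e^v = ∫ w² e^(-v)` is dual to the Poincaré inequality for `w`, since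
`∫ w² e^(-v) = -∫ w' F`. Completing the square with an arbitrary function `b` proves it for
`L = inf (v'' - b' + v' b - b²)`. If `v''` is somewhere nonpositive there is nothing to prove, and
if it attains its infimum then `b = 0` suffices. Otherwise `v''` stays away from its infimum on
compact sets, while `b = ε arctan` raises the lower bound near `±∞`, where `v'` and `arctan` have
the same sign; hence `L > inf v''`, so `L` is at least some value of `v''`.
-/

namespace HalfSpaceStability

open Filter Topology ProbabilityTheory

section RiccatiComparison

/-- The potential `v'' - b' + v' b - b²` that remains after completing the square with the vector
field `b`. Constants below it are lower bounds for the spectral gap of `e^{-v} dx`; the choice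
`b = 0` gives the Bakry–Émery bound `inf v''`. -/
noncomputable def riccatiPotential (v b : ℝ → ℝ) (x : ℝ) : ℝ :=
  deriv (deriv v) x - deriv b x + deriv v x * b x - b x ^ 2

variable {v b : ℝ → ℝ} {L p q : ℝ}

theorem intervalIntegral_sq_mul_exp_le (hv : ContDiff ℝ 2 v) (hb : ContDiff ℝ 1 b)
    (hpq : p ≤ q) (hL : ∀ x ∈ Set.Icc p q, L ≤ riccatiPotential v b x)
    {F : ℝ → ℝ} (hF : ContDiff ℝ 1 F) (hFp : F p = 0) (hFq : F q = 0) :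
    L * ∫ x in p..q, F x ^ 2 * Real.exp (v x) ≤
      ∫ x in p..q, deriv F x ^ 2 * Real.exp (v x) := by
  have hv' : ContDiff ℝ 1 (deriv v) := ContDiff.deriv' (n := 1) hv
  have hc : ContDiff ℝ 1 (b - deriv v) := hb.sub hv'
  set c := b - deriv v
  have hG : ContDiff ℝ 1 fun x => F x ^ 2 * (c x * Real.exp (v x)) :=
    (hF.pow 2).mul (hc.mul (hv.of_le one_le_two).exp)
  set G := fun x => F x ^ 2 * (c x * Real.exp (v x))
  have integral_deriv_G : ∫ x in p..q, deriv G x = 0 := by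
    rw [intervalIntegral.integral_deriv_eq_sub (fun x _ => hG.differentiable one_ne_zero x)
      (hG.continuous_deriv_one.intervalIntegrable _ _)]
    simp [G, hFp, hFq]
  have deriv_G (x : ℝ) : deriv G x = (deriv F x ^ 2 - riccatiPotential v b x * F x ^ 2 -
      (deriv F x - c x * F x) ^ 2) * Real.exp (v x) := by
    have hFx := (hF.differentiable one_ne_zero x).hasDerivAt
    have hvx := (hv.differentiable two_ne_zero x).hasDerivAt
    have hcx := (hb.differentiable one_ne_zero x).hasDerivAt.sub
      (hv'.differentiable one_ne_zero x).hasDerivAt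
    rw [((hFx.fun_pow 2).fun_mul (hcx.fun_mul hvx.exp)).deriv]
    simp only [riccatiPotential, c, Pi.sub_apply]
    push_cast
    ring
  have := hF.continuous_deriv_one
  have := hG.continuous_deriv_one
  have := hv.continuous
  rw [← intervalIntegral.integral_const_mul, ← add_zero (∫ x in p..q, _), ← integral_deriv_G,
    ← intervalIntegral.integral_add]
  · refine intervalIntegral.integral_mono_on hpq ?_ ?_ fun x hx => ?_
    · exact Continuous.intervalIntegrable (by fun_prop) _ _
    · exact Continuous.intervalIntegrable (by fun_prop) _ _
    · have potential_nonneg := mul_nonneg (sub_nonneg.2 (hL x hx))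
        (mul_nonneg (sq_nonneg (F x)) (Real.exp_pos (v x)).le)
      have square_nonneg := mul_nonneg (sq_nonneg (deriv F x - c x * F x)) (Real.exp_pos (v x)).le
      rw [deriv_G]
      linarith
  · exact Continuous.intervalIntegrable (by fun_prop) _ _
  · exact Continuous.intervalIntegrable (by fun_prop) _ _

theorem intervalIntegral_deriv_mul_eq_neg {w g F : ℝ → ℝ} (hw : ContDiff ℝ 1 w)
    (hg : Continuous g) (hF : ∀ x, HasDerivAt F (w x * g x) x) (hFp : F p = 0) (hFq : F q = 0) :
    ∫ x in p..q, deriv w x * F x = -∫ x in p..q, w x ^ 2 * g x := by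
  have := hw.continuous
  have := hw.continuous_deriv_one
  have : Continuous F := continuous_iff_continuousAt.2 fun x => (hF x).continuousAt
  have by_parts := intervalIntegral.integral_deriv_mul_eq_sub (u := w) (v := F) (a := p) (b := q)
    (fun x _ => (hw.differentiable one_ne_zero x).hasDerivAt) (fun x _ => hF x)
    (Continuous.intervalIntegrable (by fun_prop) _ _)
    (Continuous.intervalIntegrable (by fun_prop) _ _)
  rw [hFp, hFq, mul_zero, mul_zero, sub_zero, intervalIntegral.integral_add] at by_parts
  · rw [eq_neg_iff_add_eq_zero, ← by_parts]
    congr! 3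
    ring
  all_goals exact Continuous.intervalIntegrable (by fun_prop) _ _

theorem intervalIntegral_sq_mul_exp_neg_le_of_integral_eq_zero (hv : ContDiff ℝ 2 v)
    (hb : ContDiff ℝ 1 b) (hpq : p ≤ q) (hL₀ : 0 ≤ L)
    (hL : ∀ x ∈ Set.Icc p q, L ≤ riccatiPotential v b x) {w : ℝ → ℝ} (hw : ContDiff ℝ 1 w)
    (hmean : ∫ x in p..q, w x * Real.exp (-v x) = 0) :
    L * ∫ x in p..q, w x ^ 2 * Real.exp (-v x) ≤
      ∫ x in p..q, deriv w x ^ 2 * Real.exp (-v x) := by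
  have := hv.continuous
  have := hw.continuous
  have := hw.continuous_deriv_one
  set F : ℝ → ℝ := fun x => ∫ y in p..x, w y * Real.exp (-v y)
  have hasDerivAt_F (x : ℝ) : HasDerivAt F (w x * Real.exp (-v x)) x :=
    (Continuous.integral_hasStrictDerivAt (by fun_prop) p x).hasDerivAt
  have deriv_F : deriv F = fun x => w x * Real.exp (-v x) :=
    funext fun x => (hasDerivAt_F x).deriv
  have hF : ContDiff ℝ 1 F := contDiff_one_iff_deriv.2
    ⟨fun x => (hasDerivAt_F x).differentiableAt, by rw [deriv_F]; fun_prop⟩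
  have := hF.continuous
  have exp_mul_exp_neg (x : ℝ) : Real.exp (v x) * Real.exp (-v x) = 1 := by
    rw [← Real.exp_add, add_neg_cancel, Real.exp_zero]
  have hardy : L * ∫ x in p..q, F x ^ 2 * Real.exp (v x) ≤
      ∫ x in p..q, w x ^ 2 * Real.exp (-v x) := by
    convert intervalIntegral_sq_mul_exp_le hv hb hpq hL hF
      intervalIntegral.integral_same hmean using 3 with x
    rw [deriv_F]
    linear_combination (-(w x ^ 2 * Real.exp (-v x))) * exp_mul_exp_neg x
  have by_parts : ∫ x in p..q, deriv w x * F x = -∫ x in p..q, w x ^ 2 * Real.exp (-v x) :=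
    intervalIntegral_deriv_mul_eq_neg hw (by fun_prop) hasDerivAt_F
      intervalIntegral.integral_same hmean
  have square_nonneg : 0 ≤ (∫ x in p..q, deriv w x ^ 2 * Real.exp (-v x)) +
      2 * L * (∫ x in p..q, deriv w x * F x) +
      L ^ 2 * ∫ x in p..q, F x ^ 2 * Real.exp (v x) := by
    rw [← intervalIntegral.integral_const_mul, ← intervalIntegral.integral_const_mul,
      ← intervalIntegral.integral_add, ← intervalIntegral.integral_add]
    · refine intervalIntegral.integral_nonneg hpq fun x _ => ?_
      have square : deriv w x ^ 2 * Real.exp (-v x) + 2 * L * (deriv w x * F x) +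
          L ^ 2 * (F x ^ 2 * Real.exp (v x)) =
          (deriv w x * Real.exp (-v x) + L * F x) ^ 2 * Real.exp (v x) := by
        linear_combination (-(deriv w x ^ 2 * Real.exp (-v x) + 2 * L * deriv w x * F x)) *
          exp_mul_exp_neg x
      rw [square]
      positivity
    all_goals exact Continuous.intervalIntegrable (by fun_prop) _ _
  rw [by_parts] at square_nonneg
  linarith [mul_le_mul_of_nonneg_left hardy hL₀]

end RiccatiComparison

section PoincareInequality

/-- The Poincaré inequality for a measure on a normed space: `L` times the variance of a test
function is at most its Dirichlet energy. The test functions are the `C¹` functions of compact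
support. -/
def PoincareInequality {X : Type*} [NormedAddCommGroup X] [NormedSpace ℝ X] [MeasurableSpace X]
    (μ : Measure X) (L : ℝ) : Prop :=
  ∀ u : X → ℝ, ContDiff ℝ 1 u → HasCompactSupport u →
    L * Var[u; μ] ≤ ∫ x, ‖fderiv ℝ u x‖ ^ 2 ∂μ

theorem PoincareInequality.of_nonpos {X : Type*} [NormedAddCommGroup X] [NormedSpace ℝ X]
    [MeasurableSpace X] (μ : Measure X) {L : ℝ} (hL : L ≤ 0) : PoincareInequality μ L :=
  fun u _ _ => (mul_nonpos_of_nonpos_of_nonneg hL (variance_nonneg u μ)).trans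
    (integral_nonneg fun _ => sq_nonneg _)

variable {X : Type*} [MeasurableSpace X] {m : Measure X} {ψ : X → ℝ}

theorem integral_withDensity_exp (hψ : Measurable ψ) (g : X → ℝ) :
    ∫ x, g x ∂m.withDensity (fun x => ENNReal.ofReal (Real.exp (ψ x))) =
      ∫ x, g x * Real.exp (ψ x) ∂m := by
  rw [integral_withDensity_eq_integral_toReal_smul (by fun_prop) (by simp)]
  simp only [ENNReal.toReal_ofReal (Real.exp_pos _).le, smul_eq_mul, mul_comm]

theorem integrable_withDensity_exp_iff (hψ : Measurable ψ) {g : X → ℝ} :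
    Integrable g (m.withDensity fun x => ENNReal.ofReal (Real.exp (ψ x))) ↔
      Integrable (fun x => g x * Real.exp (ψ x)) m := by
  rw [integrable_withDensity_iff (by fun_prop) (by simp)]
  simp only [ENNReal.toReal_ofReal (Real.exp_pos _).le]

theorem tendsto_intervalIntegral_mul_exp {ψ g : ℝ → ℝ} (hψ : Measurable ψ)
    (hg : Integrable g (volume.withDensity fun x => ENNReal.ofReal (Real.exp (ψ x)))) :
    Tendsto (fun r => ∫ x in -r..r, g x * Real.exp (ψ x)) atTop
      (𝓝 (∫ x, g x ∂volume.withDensity fun x => ENNReal.ofReal (Real.exp (ψ x)))) := by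
  rw [integral_withDensity_exp hψ]
  exact intervalIntegral_tendsto_integral ((integrable_withDensity_exp_iff hψ).1 hg)
    tendsto_neg_atTop_atBot tendsto_id

theorem intervalIntegral_variance_le {v b u : ℝ → ℝ} {L p q : ℝ} (hv : ContDiff ℝ 2 v)
    (hb : ContDiff ℝ 1 b) (hpq : p < q) (hL₀ : 0 ≤ L)
    (hL : ∀ x ∈ Set.Icc p q, L ≤ riccatiPotential v b x) (hu : ContDiff ℝ 1 u) :
    L * ((∫ x in p..q, u x ^ 2 * Real.exp (-v x)) -
        (∫ x in p..q, u x * Real.exp (-v x)) ^ 2 / ∫ x in p..q, Real.exp (-v x)) ≤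
      ∫ x in p..q, deriv u x ^ 2 * Real.exp (-v x) := by
  have := hv.continuous
  have := hu.continuous
  have mass_pos : 0 < ∫ x in p..q, Real.exp (-v x) :=
    intervalIntegral.intervalIntegral_pos_of_pos
      (Continuous.intervalIntegrable (by fun_prop) _ _) (fun _ => Real.exp_pos _) hpq
  set M := ∫ x in p..q, Real.exp (-v x) with hM
  set A := ∫ x in p..q, u x * Real.exp (-v x) with hA
  have centered : ∫ x in p..q, (u x - A / M) * Real.exp (-v x) = 0 := by
    simp only [sub_mul]
    rw [intervalIntegral.integral_sub, intervalIntegral.integral_const_mul, ← hA, ← hM,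
      div_mul_cancel₀ _ mass_pos.ne', sub_self]
    all_goals exact Continuous.intervalIntegrable (by fun_prop) _ _
  have square_expansion : ∫ x in p..q, (u x - A / M) ^ 2 * Real.exp (-v x) =
      (∫ x in p..q, u x ^ 2 * Real.exp (-v x)) - A ^ 2 / M := by
    have expand (x : ℝ) : (u x - A / M) ^ 2 * Real.exp (-v x) = u x ^ 2 * Real.exp (-v x) -
        2 * (A / M) * (u x * Real.exp (-v x)) + (A / M) ^ 2 * Real.exp (-v x) := by ring
    simp only [expand]
    rw [intervalIntegral.integral_add, intervalIntegral.integral_sub,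
      intervalIntegral.integral_const_mul, intervalIntegral.integral_const_mul, ← hA, ← hM]
    · field_simp
      ring
    all_goals exact Continuous.intervalIntegrable (by fun_prop) _ _
  rw [← square_expansion]
  simpa using intervalIntegral_sq_mul_exp_neg_le_of_integral_eq_zero hv hb hpq.le hL₀ hL
    (hu.sub contDiff_const) centered

theorem poincareInequality_of_le_riccatiPotential {v b : ℝ → ℝ} {L : ℝ} (hv : ContDiff ℝ 2 v)
    (hb : ContDiff ℝ 1 b) {μ : Measure ℝ} [IsProbabilityMeasure μ]
    (hμ : μ = volume.withDensity fun x => ENNReal.ofReal (Real.exp (-v x)))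
    (hL₀ : 0 ≤ L) (hL : ∀ x, L ≤ riccatiPotential v b x) : PoincareInequality μ L := by
  intro u hu hsupp
  have hcu := hu.continuous
  have hcu' := hu.continuous_deriv_one
  have tendsto_integral {g : ℝ → ℝ} (hg : Integrable g μ) :
      Tendsto (fun r => ∫ x in -r..r, g x * Real.exp (-v x)) atTop (𝓝 (∫ x, g x ∂μ)) := by
    subst hμ
    exact tendsto_intervalIntegral_mul_exp hv.continuous.neg.measurable hg
  have tendsto_mass : Tendsto (fun r => ∫ x in -r..r, Real.exp (-v x)) atTop (𝓝 1) := by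
    simpa using tendsto_integral (integrable_const 1)
  have tendsto_sq {g : ℝ → ℝ} (hg : Continuous g) (hgs : HasCompactSupport g) :
      Tendsto (fun r => ∫ x in -r..r, g x ^ 2 * Real.exp (-v x)) atTop (𝓝 (∫ x, g x ^ 2 ∂μ)) :=
    tendsto_integral (hg.memLp_of_hasCompactSupport hgs).integrable_sq
  have tendsto_variance : Tendsto (fun r => L * ((∫ x in -r..r, u x ^ 2 * Real.exp (-v x)) -
      (∫ x in -r..r, u x * Real.exp (-v x)) ^ 2 / ∫ x in -r..r, Real.exp (-v x))) atTop
      (𝓝 (L * Var[u; μ])) := by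
    rw [variance_eq_sub (hcu.memLp_of_hasCompactSupport hsupp)]
    simpa using ((tendsto_sq hcu hsupp).sub
      (((tendsto_integral (hcu.integrable_of_hasCompactSupport hsupp)).pow 2).div
        tendsto_mass one_ne_zero)).const_mul L
  simp only [← norm_deriv_eq_norm_fderiv, Real.norm_eq_abs, sq_abs]
  refine le_of_tendsto_of_tendsto tendsto_variance (tendsto_sq hcu' hsupp.deriv) ?_
  filter_upwards [eventually_gt_atTop 0] with r hr
  exact intervalIntegral_variance_le hv hb (by linarith) hL₀ (fun x _ => hL x) hu

end PoincareInequality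

section SpectralGap

theorem exists_deriv_pos_of_integrable_exp_neg {v : ℝ → ℝ} (hv : Differentiable ℝ v)
    (hint : Integrable fun x => Real.exp (-v x)) : ∃ x, 0 < deriv v x := by
  by_contra! hnonpos
  have hanti : Antitone v := antitone_of_deriv_nonpos hv hnonpos
  have integrableOn_const : IntegrableOn (fun _ : ℝ => Real.exp (-v 0)) (Set.Ici 0) := by
    refine Integrable.mono' hint.integrableOn (by fun_prop) ?_
    filter_upwards [ae_restrict_mem measurableSet_Ici] with x hx
    rw [Real.norm_of_nonneg (Real.exp_pos _).le]
    exact Real.exp_le_exp.2 (neg_le_neg (hanti hx))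
  simp [integrableOn_const_iff, (Real.exp_pos _).ne'] at integrableOn_const

theorem exists_deriv_neg_of_integrable_exp_neg {v : ℝ → ℝ} (hv : Differentiable ℝ v)
    (hint : Integrable fun x => Real.exp (-v x)) : ∃ x, deriv v x < 0 := by
  obtain ⟨x, hx⟩ := exists_deriv_pos_of_integrable_exp_neg (v := fun x => v (-x)) (by fun_prop)
    hint.comp_neg
  rw [deriv_comp_neg] at hx
  exact ⟨-x, by linarith⟩

theorem exists_add_le_add_mul_of_eventually_cocompact {X : Type*} [TopologicalSpace X]
    {f g : X → ℝ} {κ δ α : ℝ} (hf : Continuous f) (hg : Continuous g) (hκ : ∀ x, κ < f x)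
    (hδ : 0 < δ) (hδg : ∀ᶠ x in cocompact X, δ ≤ g x) (hα : 0 < α) :
    ∃ ε ∈ Set.Ioc 0 α, ∃ η > 0, ∀ x, κ + η ≤ f x + ε * g x := by
  obtain ⟨K, hK, hgK⟩ := mem_cocompact.1 hδg
  obtain ⟨κ', hκκ', hfK⟩ := hK.exists_forall_le' hf.continuousOn fun x _ => hκ x
  obtain ⟨B, hB⟩ := hK.exists_bound_of_continuousOn hg.continuousOn
  have : 0 < κ' - κ := sub_pos.2 hκκ'
  have bound_pos : 0 < 2 * (|B| + 1) := by positivity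
  set ε := min α ((κ' - κ) / (2 * (|B| + 1)))
  have hε : 0 < ε := lt_min hα (by positivity)
  refine ⟨ε, ⟨hε, min_le_left _ _⟩, min (ε * δ) ((κ' - κ) / 2), by positivity, fun x => ?_⟩
  by_cases hx : x ∈ K
  · have perturbation_small : ε * (|B| + 1) ≤ (κ' - κ) / 2 := by
      have := (le_div_iff₀ bound_pos).1 (min_le_right α ((κ' - κ) / (2 * (|B| + 1))))
      linarith
    have g_lower : -(|B| + 1) ≤ g x := by
      linarith [neg_abs_le (g x), hB x hx, le_abs_self B, Real.norm_eq_abs (g x)]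
    linarith [mul_le_mul_of_nonneg_left g_lower hε.le, hfK x hx,
      min_le_right (ε * δ) ((κ' - κ) / 2)]
  · linarith [mul_le_mul_of_nonneg_left (hgK hx) hε.le, hκ x, min_le_left (ε * δ) ((κ' - κ) / 2)]

theorem eventually_atTop_le_mul_arctan_sub {φ : ℝ → ℝ} {c : ℝ} (hc : 0 < c)
    (hφ : ∀ᶠ x in atTop, c ≤ φ x) :
    ∀ᶠ x in atTop, c * Real.pi / 8 ≤
      φ x * Real.arctan x - 1 / (1 + x ^ 2) - c / Real.pi * Real.arctan x ^ 2 := by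
  have tendsto_arctan : Tendsto Real.arctan atTop (𝓝 (Real.pi / 2)) :=
    Real.tendsto_arctan_atTop.mono_right nhdsWithin_le_nhds
  have tendsto_inv : Tendsto (fun x : ℝ => 1 / (1 + x ^ 2)) atTop (𝓝 0) :=
    tendsto_const_nhds.div_atTop
      (tendsto_atTop_add_const_left _ _ (tendsto_pow_atTop two_ne_zero))
  have tendsto_drift : Tendsto
      (fun x => c * Real.arctan x - 1 / (1 + x ^ 2) - c / Real.pi * Real.arctan x ^ 2) atTop
      (𝓝 (c * Real.pi / 4)) := by
    convert ((tendsto_arctan.const_mul c).sub tendsto_inv).sub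
      ((tendsto_arctan.pow 2).const_mul (c / Real.pi)) using 2
    field_simp
    ring
  have limit_pos : 0 < c * Real.pi := mul_pos hc Real.pi_pos
  filter_upwards [hφ, eventually_ge_atTop 0,
    tendsto_drift.eventually_const_le (show c * Real.pi / 8 < c * Real.pi / 4 by linarith)]
    with x hφx hx hdrift
  linarith [mul_le_mul_of_nonneg_right hφx (Real.arctan_nonneg.2 hx)]

theorem eventually_cocompact_le_mul_arctan_sub {φ : ℝ → ℝ} {c : ℝ} (hc : 0 < c)
    (htop : ∀ᶠ x in atTop, c ≤ φ x) (hbot : ∀ᶠ x in atBot, φ x ≤ -c) :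
    ∀ᶠ x in cocompact ℝ, c * Real.pi / 8 ≤
      φ x * Real.arctan x - 1 / (1 + x ^ 2) - c / Real.pi * Real.arctan x ^ 2 := by
  rw [cocompact_eq_atBot_atTop, eventually_sup]
  refine ⟨?_, eventually_atTop_le_mul_arctan_sub hc htop⟩
  have reflected : ∀ᶠ x in atTop, c ≤ -φ (-x) :=
    (tendsto_neg_atTop_atBot.eventually hbot).mono fun x hx => by linarith
  filter_upwards [tendsto_neg_atBot_atTop.eventually
    (eventually_atTop_le_mul_arctan_sub hc reflected)] with x hx
  simpa [Real.arctan_neg] using hx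

variable {v : ℝ → ℝ}

theorem riccatiPotential_zero (x : ℝ) : riccatiPotential v 0 x = deriv (deriv v) x := by
  simp [riccatiPotential]

theorem riccatiPotential_mul_arctan (ε x : ℝ) :
    riccatiPotential v (fun y => ε * Real.arctan y) x = deriv (deriv v) x +
      ε * (deriv v x * Real.arctan x - 1 / (1 + x ^ 2) - ε * Real.arctan x ^ 2) := by
  rw [riccatiPotential, deriv_const_mul _ (Real.differentiableAt_arctan x), Real.deriv_arctan]
  ring

theorem exists_pos_eventually_deriv (hv : ContDiff ℝ 2 v)
    (hint : Integrable fun x => Real.exp (-v x)) (hpos : ∀ x, 0 < deriv (deriv v) x) :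
    ∃ c > 0, (∀ᶠ x in atTop, c ≤ deriv v x) ∧ ∀ᶠ x in atBot, deriv v x ≤ -c := by
  have hmono : Monotone (deriv v) := monotone_of_deriv_nonneg
    ((ContDiff.deriv' (n := 1) hv).differentiable one_ne_zero) fun x => (hpos x).le
  obtain ⟨x₁, hx₁⟩ :=
    exists_deriv_pos_of_integrable_exp_neg (hv.differentiable two_ne_zero) hint
  obtain ⟨x₂, hx₂⟩ :=
    exists_deriv_neg_of_integrable_exp_neg (hv.differentiable two_ne_zero) hint
  refine ⟨min (deriv v x₁) (-deriv v x₂), lt_min hx₁ (neg_pos.2 hx₂), ?_, ?_⟩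
  · filter_upwards [eventually_ge_atTop x₁] with x hx
    exact (min_le_left _ _).trans (hmono hx)
  · filter_upwards [eventually_le_atBot x₂] with x hx
    exact (hmono hx).trans (le_neg_of_le_neg (min_le_right _ _))

theorem exists_deriv_deriv_le_riccatiPotential (hv : ContDiff ℝ 2 v)
    (hint : Integrable fun x => Real.exp (-v x)) (hpos : ∀ x, 0 < deriv (deriv v) x) :
    ∃ (t : ℝ) (b : ℝ → ℝ), ContDiff ℝ 1 b ∧
      ∀ x, deriv (deriv v) t ≤ riccatiPotential v b x := by
  by_cases attained : ∃ t, ∀ x, deriv (deriv v) t ≤ deriv (deriv v) x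
  · obtain ⟨t, ht⟩ := attained
    exact ⟨t, 0, contDiff_const, fun x => (ht x).trans_eq (riccatiPotential_zero x).symm⟩
  push Not at attained
  have hv' : ContDiff ℝ 1 (deriv v) := ContDiff.deriv' (n := 1) hv
  have bddBelow : BddBelow (Set.range (deriv (deriv v))) :=
    ⟨0, Set.forall_mem_range.2 fun x => (hpos x).le⟩
  have iInf_lt (x : ℝ) : ⨅ y, deriv (deriv v) y < deriv (deriv v) x :=
    (attained x).elim fun y hy => (ciInf_le bddBelow y).trans_lt hy
  obtain ⟨c, hc, htop, hbot⟩ := exists_pos_eventually_deriv hv hint hpos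
  have continuous_drift : Continuous fun x =>
      deriv v x * Real.arctan x - 1 / (1 + x ^ 2) - c / Real.pi * Real.arctan x ^ 2 := by
    have := hv'.continuous
    have denom_ne_zero (x : ℝ) : 1 + x ^ 2 ≠ 0 := by positivity
    fun_prop (disch := assumption)
  obtain ⟨ε, ⟨hε, hεc⟩, η, hη, hgap⟩ := exists_add_le_add_mul_of_eventually_cocompact
    hv'.continuous_deriv_one continuous_drift iInf_lt (by positivity)
    (eventually_cocompact_le_mul_arctan_sub hc htop hbot) (div_pos hc Real.pi_pos)
  obtain ⟨t, ht⟩ := exists_lt_of_ciInf_lt (lt_add_of_pos_right (⨅ y, deriv (deriv v) y) hη)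
  refine ⟨t, fun x => ε * Real.arctan x, contDiff_const.mul Real.contDiff_arctan, fun x => ?_⟩
  rw [riccatiPotential_mul_arctan]
  refine ht.le.trans ((hgap x).trans ?_)
  gcongr

theorem exists_poincareInequality_deriv_deriv (hv : ContDiff ℝ 2 v) {μ : Measure ℝ}
    [IsProbabilityMeasure μ]
    (hμ : μ = volume.withDensity fun x => ENNReal.ofReal (Real.exp (-v x))) :
    ∃ t, PoincareInequality μ (deriv (deriv v) t) := by
  by_cases nonpos : ∃ t, deriv (deriv v) t ≤ 0
  · exact nonpos.imp fun t ht => PoincareInequality.of_nonpos μ ht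
  push Not at nonpos
  have hint : Integrable fun x => Real.exp (-v x) := by
    subst hμ
    simpa using (integrable_withDensity_exp_iff hv.continuous.neg.measurable).1
      (integrable_const (1 : ℝ))
  obtain ⟨t, b, hb, ht⟩ := exists_deriv_deriv_le_riccatiPotential hv hint nonpos
  exact ⟨t, poincareInequality_of_le_riccatiPotential hv hb hμ (nonpos t).le ht⟩

end SpectralGap

section ProductVariance

variable {X Y : Type*} [MeasurableSpace X] [MeasurableSpace Y] {μ : Measure X} {ν : Measure Y}
  [IsProbabilityMeasure μ] [IsProbabilityMeasure ν] {U : X × Y → ℝ}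

theorem sq_integral_le_integral_sq {f : X → ℝ} (hf : MemLp f 2 μ) :
    (∫ x, f x ∂μ) ^ 2 ≤ ∫ x, f x ^ 2 ∂μ := by
  have h := variance_nonneg f μ
  rw [variance_eq_sub hf] at h
  exact sub_nonneg.1 h

theorem ae_memLp_two_prodMk_left (hU : MemLp U 2 (μ.prod ν)) :
    ∀ᵐ x ∂μ, MemLp (fun y => U (x, y)) 2 ν := by
  filter_upwards [hU.integrable_sq.prod_right_ae, hU.aestronglyMeasurable.prodMk_left]
    with x hx hxm using (memLp_two_iff_integrable_sq hxm).2 hx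

theorem ae_sq_integral_prodMk_left_le (hU : MemLp U 2 (μ.prod ν)) :
    ∀ᵐ x ∂μ, (∫ y, U (x, y) ∂ν) ^ 2 ≤ ∫ y, U (x, y) ^ 2 ∂ν :=
  (ae_memLp_two_prodMk_left hU).mono fun _ => sq_integral_le_integral_sq

theorem memLp_two_integral_prodMk_left (hU : MemLp U 2 (μ.prod ν)) :
    MemLp (fun x => ∫ y, U (x, y) ∂ν) 2 μ := by
  have hm := hU.aestronglyMeasurable.integral_prod_right'
  refine (memLp_two_iff_integrable_sq hm).2
    (hU.integrable_sq.integral_prod_left.mono' (hm.pow 2) ?_)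
  filter_upwards [ae_sq_integral_prodMk_left_le hU] with x hx
  rwa [Real.norm_of_nonneg (sq_nonneg _)]

theorem variance_prod_eq (hU : MemLp U 2 (μ.prod ν)) :
    Var[U; μ.prod ν] =
      ∫ x, Var[fun y => U (x, y); ν] ∂μ + Var[fun x => ∫ y, U (x, y) ∂ν; μ] := by
  have integral_conditional : ∫ x, Var[fun y => U (x, y); ν] ∂μ =
      ∫ p, U p ^ 2 ∂μ.prod ν - ∫ x, (∫ y, U (x, y) ∂ν) ^ 2 ∂μ := by
    rw [integral_prod _ hU.integrable_sq, ← integral_sub hU.integrable_sq.integral_prod_left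
      (memLp_two_integral_prodMk_left hU).integrable_sq]
    refine integral_congr_ae ?_
    filter_upwards [ae_memLp_two_prodMk_left hU] with x hx using variance_eq_sub hx
  rw [integral_conditional, variance_eq_sub hU,
    variance_eq_sub (memLp_two_integral_prodMk_left hU), integral_prod _ (hU.integrable one_le_two)]
  simp only [Pi.pow_apply]
  ring

theorem variance_integral_le (hU : MemLp U 2 (μ.prod ν)) :
    Var[fun x => ∫ y, U (x, y) ∂ν; μ] ≤ ∫ y, Var[fun x => U (x, y); μ] ∂ν := by
  have memLp_mean : MemLp (fun y => ∫ x, U (x, y) ∂μ) 2 ν :=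
    memLp_two_integral_prodMk_left (hU.comp_measurePreserving Measure.measurePreserving_swap)
  have hV : MemLp (fun p : X × Y => U p - ∫ x, U (x, p.2) ∂μ) 2 (μ.prod ν) :=
    hU.sub (memLp_mean.comp_snd μ)
  have hUi := hU.integrable one_le_two
  rw [variance_eq_integral (memLp_two_integral_prodMk_left hU).aestronglyMeasurable.aemeasurable,
    integral_integral_swap (f := fun x y => U (x, y)) hUi]
  calc ∫ x, ((∫ y, U (x, y) ∂ν) - ∫ y, ∫ x, U (x, y) ∂μ ∂ν) ^ 2 ∂μ
      = ∫ x, (∫ y, U (x, y) - ∫ x', U (x', y) ∂μ ∂ν) ^ 2 ∂μ := by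
        refine integral_congr_ae ?_
        filter_upwards [hUi.prod_right_ae] with x hx
        rw [integral_sub hx (memLp_mean.integrable one_le_two)]
    _ ≤ ∫ x, ∫ y, (U (x, y) - ∫ x', U (x', y) ∂μ) ^ 2 ∂ν ∂μ :=
        integral_mono_ae (memLp_two_integral_prodMk_left hV).integrable_sq
          hV.integrable_sq.integral_prod_left (ae_sq_integral_prodMk_left_le hV)
    _ = ∫ y, ∫ x, (U (x, y) - ∫ x', U (x', y) ∂μ) ^ 2 ∂μ ∂ν :=
        integral_integral_swap hV.integrable_sq
    _ = ∫ y, Var[fun x => U (x, y); μ] ∂ν := by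
        refine integral_congr_ae ?_
        filter_upwards [hUi.prod_left_ae] with y hy
        rw [variance_eq_integral hy.aestronglyMeasurable.aemeasurable]

theorem variance_prod_le (hU : MemLp U 2 (μ.prod ν)) :
    Var[U; μ.prod ν] ≤
      ∫ x, Var[fun y => U (x, y); ν] ∂μ + ∫ y, Var[fun x => U (x, y); μ] ∂ν := by
  rw [variance_prod_eq hU]
  gcongr
  exact variance_integral_le hU

end ProductVariance

section ProductEnergy

variable {X Y : Type*} [NormedAddCommGroup X] [NormedSpace ℝ X] [MeasurableSpace X] [BorelSpace X]
  [NormedAddCommGroup Y] [NormedSpace ℝ Y] [MeasurableSpace Y] [BorelSpace Y]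
  {μ : Measure X} {ν : Measure Y} [IsProbabilityMeasure μ]
  [IsProbabilityMeasure ν] {L : ℝ} {u : X × Y → ℝ}

theorem integrable_norm_sq_fderiv_comp {Z W : Type*} [NormedAddCommGroup Z] [NormedSpace ℝ Z]
    [MeasurableSpace Z] [BorelSpace Z] [NormedAddCommGroup W] [NormedSpace ℝ W] {m : Measure Z}
    [IsFiniteMeasureOnCompacts m] {f : Z → ℝ} (hf : ContDiff ℝ 1 f) (hs : HasCompactSupport f)
    (A : W →L[ℝ] Z) : Integrable (fun z => ‖(fderiv ℝ f z).comp A‖ ^ 2) m := by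
  have := hf.continuous_fderiv one_ne_zero
  refine Continuous.integrable_of_hasCompactSupport (by fun_prop) ?_
  exact (hs.fderiv (𝕜 := ℝ)).comp_left (g := fun T : Z →L[ℝ] ℝ => ‖T.comp A‖ ^ 2) (by simp)

theorem integral_variance_prodMk_left_le [SecondCountableTopologyEither X Y]
    (hν : PoincareInequality ν L) (hL : 0 ≤ L)
    (hu : ContDiff ℝ 1 u) (hs : HasCompactSupport u) :
    L * ∫ x, Var[fun y => u (x, y); ν] ∂μ ≤
      ∫ p, ‖(fderiv ℝ u p).comp (.inr ℝ X Y)‖ ^ 2 ∂μ.prod ν := by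
  have integrable_energy := integrable_norm_sq_fderiv_comp (m := μ.prod ν) hu hs (.inr ℝ X Y)
  rw [← integral_const_mul, integral_prod _ integrable_energy]
  refine integral_mono_of_nonneg (ae_of_all _ fun x => mul_nonneg hL (variance_nonneg _ _))
    integrable_energy.integral_prod_left (ae_of_all _ fun x => ?_)
  refine (hν (fun y => u (x, y)) (by fun_prop) (hs.comp_isClosedEmbedding
    (Function.LeftInverse.isClosedEmbedding (f := Prod.snd) (fun _ => rfl) continuous_snd
      (by fun_prop)))).trans_eq (integral_congr_ae (ae_of_all _ fun y => ?_))
  have hasFDerivAt_slice := ((hu.differentiable one_ne_zero (x, y)).hasFDerivAt).comp y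
    (hasFDerivAt_prodMk_right x y)
  exact congrArg (fun T : Y →L[ℝ] ℝ => ‖T‖ ^ 2) hasFDerivAt_slice.fderiv

theorem PoincareInequality.prod [SecondCountableTopology X] (hμ : PoincareInequality μ L)
    (hν : PoincareInequality ν L) (hu : ContDiff ℝ 1 u) (hs : HasCompactSupport u) :
    L * Var[u; μ.prod ν] ≤ ∫ p, (‖(fderiv ℝ u p).comp (.inl ℝ X Y)‖ ^ 2 +
      ‖(fderiv ℝ u p).comp (.inr ℝ X Y)‖ ^ 2) ∂μ.prod ν := by
  rcases le_total L 0 with hL | hL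
  · exact (mul_nonpos_of_nonpos_of_nonneg hL (variance_nonneg _ _)).trans
      (integral_nonneg fun _ => by positivity)
  let swap := ContinuousLinearEquiv.prodComm ℝ Y X
  have energy_swap : ∫ p, ‖(fderiv ℝ (u ∘ swap) p).comp (.inr ℝ Y X)‖ ^ 2 ∂ν.prod μ =
      ∫ p, ‖(fderiv ℝ u p).comp (.inl ℝ X Y)‖ ^ 2 ∂μ.prod ν := by
    rw [← integral_prod_swap]
    simp only [swap.comp_right_fderiv]
    rfl
  calc L * Var[u; μ.prod ν]
      ≤ L * (∫ x, Var[fun y => u (x, y); ν] ∂μ + ∫ y, Var[fun x => u (x, y); μ] ∂ν) := by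
        gcongr
        exact variance_prod_le (hu.continuous.memLp_of_hasCompactSupport hs)
    _ ≤ _ := by
        rw [integral_add (integrable_norm_sq_fderiv_comp hu hs _)
          (integrable_norm_sq_fderiv_comp hu hs _), mul_add, add_comm, ← energy_swap]
        exact add_le_add (integral_variance_prodMk_left_le (u := u ∘ swap) hμ hL
          (hu.comp swap.contDiff) (hs.comp_homeomorph swap.toHomeomorph))
          (integral_variance_prodMk_left_le hν hL hu hs)

end ProductEnergy

section Snoc

variable {n : ℕ}

/-- The splitting of the last coordinate `t` from the other coordinates `y` of a point of
`ℝ^(n+1)`. The last coordinate comes first in the pair, as in `Fin.snocEquiv`. -/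
noncomputable def snocEquiv (n : ℕ) : (ℝ × E n) ≃L[ℝ] E (n + 1) :=
  LinearEquiv.toContinuousLinearEquiv
    { toFun p := WithLp.toLp 2 (Fin.snoc p.2 p.1)
      invFun x := (x (Fin.last n), WithLp.toLp 2 fun i => x i.castSucc)
      map_add' p q := by
        ext i
        refine Fin.lastCases ?_ (fun j => ?_) i <;> simp
      map_smul' c p := by
        ext i
        refine Fin.lastCases ?_ (fun j => ?_) i <;> simp
      left_inv p := by simp
      right_inv x := by
        ext i
        refine Fin.lastCases ?_ (fun j => ?_) i <;> simp }

@[simp]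
theorem snocEquiv_apply_last (p : ℝ × E n) : snocEquiv n p (Fin.last n) = p.1 :=
  Fin.snoc_last (α := fun _ => ℝ) ..

@[simp]
theorem snocEquiv_apply_castSucc (p : ℝ × E n) (i : Fin n) :
    snocEquiv n p i.castSucc = p.2 i :=
  Fin.snoc_castSucc (α := fun _ => ℝ) ..

theorem inner_snocEquiv (p q : ℝ × E n) :
    inner ℝ (snocEquiv n p) (snocEquiv n q) = p.1 * q.1 + inner ℝ p.2 q.2 := by
  simp only [PiLp.inner_apply, Fin.sum_univ_castSucc, snocEquiv_apply_castSucc,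
    snocEquiv_apply_last, RCLike.inner_apply, conj_trivial]
  ring

theorem norm_sq_snocEquiv (p : ℝ × E n) : ‖snocEquiv n p‖ ^ 2 = p.1 ^ 2 + ‖p.2‖ ^ 2 := by
  rw [← real_inner_self_eq_norm_sq, inner_snocEquiv, real_inner_self_eq_norm_sq, ← sq]

theorem innerSL_snocEquiv_comp_inl (p : ℝ × E n) :
    ((innerSL ℝ (snocEquiv n p)).comp (snocEquiv n : ℝ × E n →L[ℝ] E (n + 1))).comp
      (.inl ℝ ℝ (E n)) = innerSL ℝ p.1 := by
  ext
  simp [inner_snocEquiv]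

theorem innerSL_snocEquiv_comp_inr (p : ℝ × E n) :
    ((innerSL ℝ (snocEquiv n p)).comp (snocEquiv n : ℝ × E n →L[ℝ] E (n + 1))).comp
      (.inr ℝ ℝ (E n)) = innerSL ℝ p.2 := by
  ext y
  simp [inner_snocEquiv]

theorem norm_sq_eq_norm_sq_comp_snocEquiv (T : E (n + 1) →L[ℝ] ℝ) :
    ‖T‖ ^ 2 = ‖(T.comp (snocEquiv n : ℝ × E n →L[ℝ] E (n + 1))).comp (.inl ℝ ℝ (E n))‖ ^ 2 +
      ‖(T.comp (snocEquiv n : ℝ × E n →L[ℝ] E (n + 1))).comp (.inr ℝ ℝ (E n))‖ ^ 2 := by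
  obtain ⟨g, rfl⟩ := (InnerProductSpace.toDual ℝ (E (n + 1))).surjective T
  obtain ⟨p, rfl⟩ := (snocEquiv n).surjective g
  change ‖innerSL ℝ (snocEquiv n p)‖ ^ 2 = ‖((innerSL ℝ (snocEquiv n p)).comp _).comp _‖ ^ 2 +
    ‖((innerSL ℝ (snocEquiv n p)).comp _).comp _‖ ^ 2
  rw [innerSL_snocEquiv_comp_inl, innerSL_snocEquiv_comp_inr]
  simp only [innerSL_apply_norm, norm_sq_snocEquiv, Real.norm_eq_abs, sq_abs]

theorem measurePreserving_toLp (μ : Measure ℝ) (d : ℕ) :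
    MeasurePreserving (MeasurableEquiv.toLp 2 (Fin d → ℝ)) (Measure.pi fun _ => μ)
      (productMeasure μ d) :=
  ⟨MeasurableEquiv.measurable _, rfl⟩

theorem measurePreserving_snocEquiv (μ : Measure ℝ) [SigmaFinite μ] (n : ℕ) :
    MeasurePreserving (snocEquiv n) (μ.prod (productMeasure μ n)) (productMeasure μ (n + 1)) := by
  have ofLp := (measurePreserving_toLp μ n).symm
  have : SigmaFinite (productMeasure μ n) := ofLp.sigmaFinite
  have insertNth := (measurePreserving_piFinSuccAbove (fun _ => μ) (Fin.last n)).symm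
  convert ((measurePreserving_toLp μ (n + 1)).comp insertNth).comp
    ((MeasurePreserving.id μ).prod ofLp) using 1
  ext p i
  refine Fin.lastCases ?_ (fun j => ?_) i <;>
    simp [MeasurableEquiv.piFinSuccAbove_symm_apply, Fin.insertNthEquiv]

instance isProbabilityMeasure_productMeasure (μ : Measure ℝ) [IsProbabilityMeasure μ] (d : ℕ) :
    IsProbabilityMeasure (productMeasure μ d) :=
  Measure.isProbabilityMeasure_map (MeasurableEquiv.toLp 2 (Fin d → ℝ)).measurable.aemeasurable

theorem PoincareInequality.productMeasure {μ : Measure ℝ} [IsProbabilityMeasure μ] {L : ℝ}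
    (hμ : PoincareInequality μ L) (d : ℕ) : PoincareInequality (productMeasure μ d) L := by
  induction d with
  | zero =>
    intro u _ _
    rw [show u = fun _ => u 0 from funext fun x => congrArg u (Subsingleton.elim x 0)]
    simp [variance_eq_integral aemeasurable_const]
  | succ n ih =>
    intro u hu hs
    have hpres := measurePreserving_snocEquiv μ n
    rw [← hpres.variance_fun_comp hu.continuous.aemeasurable,
      ← hpres.integral_comp (snocEquiv n).toHomeomorph.measurableEmbedding]
    refine (hμ.prod ih (hu.comp (snocEquiv n).contDiff)
      (hs.comp_homeomorph (snocEquiv n).toHomeomorph)).trans_eq ?_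
    simp only [(snocEquiv n).comp_right_fderiv, norm_sq_eq_norm_sq_comp_snocEquiv]

end Snoc

section LogDensity

variable {v : ℝ → ℝ} {d n : ℕ}

/-- The function `-v ⊕ ⋯ ⊕ -v` on `ℝ^d`, the logarithm of the density of `μ^d` for
`dμ = e^(-v) dx`. -/
noncomputable def logDensity (v : ℝ → ℝ) (d : ℕ) (x : E d) : ℝ := ∑ i, -v (x i)

theorem logDensity_snocEquiv (v : ℝ → ℝ) (p : ℝ × E n) :
    logDensity v (n + 1) (snocEquiv n p) = -v p.1 + logDensity v n p.2 := by
  simp [logDensity, Fin.sum_univ_castSucc, add_comm]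

@[fun_prop]
theorem measurable_logDensity (hv : Measurable v) (d : ℕ) : Measurable (logDensity v d) := by
  unfold logDensity
  fun_prop

theorem contDiff_logDensity {k : WithTop ℕ∞} (hv : ContDiff ℝ k v) (d : ℕ) :
    ContDiff ℝ k (logDensity v d) :=
  ContDiff.sum fun _ _ => (hv.comp (by fun_prop)).neg

theorem productMeasure_withDensity_exp_neg (hv : Measurable v) (d : ℕ) :
    productMeasure (volume.withDensity fun x => ENNReal.ofReal (Real.exp (-v x))) d =
      volume.withDensity fun x => ENNReal.ofReal (Real.exp (logDensity v d x)) := by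
  have volume_eq (k : ℕ) : productMeasure volume k = (volume : Measure (E k)) :=
    (PiLp.volume_preserving_toLp (Fin k)).map_eq
  induction d with
  | zero =>
    rw [← volume_eq 0]
    simp only [logDensity, productMeasure, Finset.univ_eq_empty, Finset.sum_empty, Real.exp_zero,
      ENNReal.ofReal_one]
    rw [← Pi.one_def, withDensity_one, Measure.pi_of_empty, Measure.pi_of_empty]
  | succ n ih =>
    rw [← (measurePreserving_snocEquiv _ n).map_eq, ih, prod_withDensity (by fun_prop)
      (by fun_prop)]
    have hpres := measurePreserving_snocEquiv volume n
    rw [volume_eq, volume_eq] at hpres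
    ext s hs
    rw [Measure.map_apply hpres.measurable hs, withDensity_apply _ (hpres.measurable hs),
      withDensity_apply _ hs, ← hpres.setLIntegral_comp_preimage hs (by fun_prop)]
    simp only [logDensity_snocEquiv, Real.exp_add, ENNReal.ofReal_mul (Real.exp_pos _).le]

theorem hasLogDensity_productMeasure (hv : ContDiff ℝ 2 v) {μ : Measure ℝ}
    (hμ : μ = volume.withDensity fun x => ENNReal.ofReal (Real.exp (-v x))) (d : ℕ) :
    HasLogDensity (productMeasure μ d) (logDensity v d) :=
  ⟨contDiff_logDensity hv d, hμ ▸ productMeasure_withDensity_exp_neg hv.continuous.measurable d⟩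

theorem hasFDerivAt_sum_comp_apply {F : Type*} [NormedAddCommGroup F] [NormedSpace ℝ F]
    {f : Fin d → ℝ → F} {x : E d} (hf : ∀ i, DifferentiableAt ℝ (f i) (x i)) :
    HasFDerivAt (fun y : E d => ∑ i, f i (y i))
      (∑ i, (EuclideanSpace.proj i : E d →L[ℝ] ℝ).smulRight (deriv (f i) (x i))) x := by
  refine HasFDerivAt.fun_sum fun i _ => ?_
  exact (hf i).hasDerivAt.hasFDerivAt.comp x (EuclideanSpace.proj i : E d →L[ℝ] ℝ).hasFDerivAt

theorem fderiv_logDensity (hv : Differentiable ℝ v) :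
    fderiv ℝ (logDensity v d) =
      fun x => ∑ i, -deriv v (x i) • (EuclideanSpace.proj i : E d →L[ℝ] ℝ) := by
  ext x y
  unfold logDensity
  rw [(hasFDerivAt_sum_comp_apply fun i => (hv (x i)).fun_neg).fderiv]
  simp [deriv.fun_neg, mul_comm]

theorem fderiv_fderiv_logDensity (hv : ContDiff ℝ 2 v) (x y z : E d) :
    fderiv ℝ (fderiv ℝ (logDensity v d)) x y z = ∑ i, -deriv (deriv v) (x i) * y i * z i := by
  have hv' : Differentiable ℝ (deriv v) :=
    (ContDiff.deriv' (n := 1) hv).differentiable one_ne_zero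
  rw [fderiv_logDensity (hv.differentiable two_ne_zero),
    (hasFDerivAt_sum_comp_apply (f := fun i s => -deriv v s • (EuclideanSpace.proj i : E d →L[ℝ] ℝ))
      fun i => (hv' (x i)).fun_neg.smul_const _).fderiv]
  simp [deriv_smul_const, hv' _, mul_left_comm, mul_assoc]

end LogDensity

section HeightFunction

variable {d : ℕ} {e : E d} {t : ℝ}

/-- The height of a point above the hyperplane `{⟨e, x⟩ = t}`, a defining function of the
half-space below it. -/
noncomputable def heightFunction (e : E d) (t : ℝ) (x : E d) : ℝ := inner ℝ e x - t

@[simp]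
theorem gradient_heightFunction (e : E d) (t : ℝ) (x : E d) :
    gradient (heightFunction e t) x = e := by
  have hderiv : HasFDerivAt (heightFunction e t) (innerSL ℝ e) x :=
    (innerSL ℝ e).hasFDerivAt.sub_const t
  exact ext_inner_right ℝ fun y => by rw [inner_gradient_left, hderiv.fderiv, innerSL_apply_apply]

theorem unitNormal_heightFunction (he : ‖e‖ = 1) (t : ℝ) :
    unitNormal (heightFunction e t) = fun _ => e := by
  ext1 x
  simp [unitNormal, he]

theorem shapeOperator_heightFunction (e : E d) (t : ℝ) (x : E d) :
    shapeOperator (heightFunction e t) x = 0 := by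
  have unitNormal_const : unitNormal (heightFunction e t) = fun _ => ‖e‖⁻¹ • e := by
    ext1 x
    simp [unitNormal]
  simp [shapeOperator, unitNormal_const]

theorem isOpenMap_inner_right (he : e ≠ 0) : IsOpenMap fun x : E d => inner ℝ e x :=
  (innerSL ℝ e).isOpenMap_of_ne_zero <| norm_ne_zero_iff.1 <| by
    rwa [innerSL_apply_norm, norm_ne_zero_iff]

theorem interior_halfSpace (he : e ≠ 0) (t : ℝ) :
    interior {x : E d | inner ℝ e x ≤ t} = {x | inner ℝ e x < t} := by
  have := (isOpenMap_inner_right he).preimage_interior_eq_interior_preimage (by fun_prop)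
    (Set.Iic t)
  rw [interior_Iic] at this
  exact this.symm

theorem frontier_halfSpace (he : e ≠ 0) (t : ℝ) :
    frontier {x : E d | inner ℝ e x ≤ t} = {x | inner ℝ e x = t} := by
  have := (isOpenMap_inner_right he).preimage_frontier_eq_frontier_preimage (by fun_prop)
    (Set.Iic t)
  rw [frontier_Iic] at this
  exact this.symm

theorem isDefiningFunction_heightFunction (he : e ≠ 0) (t : ℝ) :
    IsDefiningFunction (heightFunction e t) {x | inner ℝ e x ≤ t} where
  contDiff := (contDiff_const.inner ℝ contDiff_id).sub contDiff_const
  interior_eq := by simp only [interior_halfSpace he, heightFunction, sub_neg]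
  frontier_eq := by simp only [frontier_halfSpace he, heightFunction, sub_eq_zero]
  gradient_ne_zero x _ := by rwa [gradient_heightFunction]

end HeightFunction

section CoordHalfSpace

variable {N : ℕ} {t : ℝ}

/-- The last vector of the standard basis, the outer unit normal of `coordHalfSpace N t`. -/
noncomputable def lastVector (N : ℕ) : E (N + 1) := snocEquiv N (1, 0)

theorem inner_lastVector (x : E (N + 1)) : inner ℝ (lastVector N) x = x (Fin.last N) := by
  obtain ⟨p, rfl⟩ := (snocEquiv N).surjective x
  simp [lastVector, inner_snocEquiv]

theorem norm_lastVector : ‖lastVector N‖ = 1 := by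
  rw [← sq_eq_sq₀ (norm_nonneg _) zero_le_one, lastVector, norm_sq_snocEquiv]
  simp

theorem lastVector_ne_zero : lastVector N ≠ 0 :=
  norm_ne_zero_iff.1 (norm_lastVector.trans_ne one_ne_zero)

theorem coordHalfSpace_eq (N : ℕ) (t : ℝ) :
    coordHalfSpace N t = {x | inner ℝ (lastVector N) x ≤ t} := by
  simp only [coordHalfSpace, inner_lastVector]

theorem frontier_coordHalfSpace (N : ℕ) (t : ℝ) :
    frontier (coordHalfSpace N t) = {x | x (Fin.last N) = t} := by
  rw [coordHalfSpace_eq, frontier_halfSpace lastVector_ne_zero]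
  simp only [inner_lastVector]

theorem tangentProj_heightFunction_lastVector (t : ℝ) (x : E (N + 1)) (p : ℝ × E N) :
    tangentProj (heightFunction (lastVector N) t) x (snocEquiv N p) = snocEquiv N (0, p.2) := by
  simp only [tangentProj, unitNormal_heightFunction norm_lastVector]
  rw [Submodule.starProjection_orthogonal', sub_apply,
    Submodule.starProjection_unit_singleton ℝ norm_lastVector, inner_lastVector, lastVector,
    ← map_smul, one_apply_eq_self]
  simp [← map_sub, Prod.ext_iff]

theorem norm_tangentialGradient_heightFunction {u : E (N + 1) → ℝ} {s : ℝ} {y : E N}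
    (hu : DifferentiableAt ℝ u (snocEquiv N (s, y))) (t : ℝ) :
    ‖tangentialGradient (heightFunction (lastVector N) t) u (snocEquiv N (s, y))‖ =
      ‖fderiv ℝ (fun z => u (snocEquiv N (s, z))) y‖ := by
  obtain ⟨p, hp⟩ := (snocEquiv N).surjective (gradient u (snocEquiv N (s, y)))
  have fderiv_eq : fderiv ℝ u (snocEquiv N (s, y)) = innerSL ℝ (snocEquiv N p) := by
    ext z
    rw [hp, innerSL_apply_apply, inner_gradient_left]
  have slice : HasFDerivAt (fun z => u (snocEquiv N (s, z)))
      (((innerSL ℝ (snocEquiv N p)).comp (snocEquiv N : ℝ × E N →L[ℝ] E (N + 1))).comp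
        (.inr ℝ ℝ (E N))) y :=
    ((fderiv_eq ▸ hu.hasFDerivAt).comp (s, y) (snocEquiv N).hasFDerivAt).comp y
      (hasFDerivAt_prodMk_right s y)
  rw [slice.fderiv, innerSL_snocEquiv_comp_inr, innerSL_apply_norm, tangentialGradient, ← hp,
    tangentProj_heightFunction_lastVector, ← sq_eq_sq₀ (norm_nonneg _) (norm_nonneg _),
    norm_sq_snocEquiv]
  simp

theorem isometry_snocEquiv_prodMk (N : ℕ) (t : ℝ) : Isometry fun y : E N => snocEquiv N (t, y) := by
  refine Isometry.of_dist_eq fun y z => ?_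
  rw [dist_eq_norm, dist_eq_norm, ← map_sub, ← sq_eq_sq₀ (norm_nonneg _) (norm_nonneg _),
    norm_sq_snocEquiv]
  simp

theorem range_snocEquiv_prodMk (N : ℕ) (t : ℝ) :
    Set.range (fun y : E N => snocEquiv N (t, y)) = {x | x (Fin.last N) = t} := by
  ext x
  obtain ⟨⟨s, z⟩, rfl⟩ := (snocEquiv N).surjective x
  simp [eq_comm]

theorem boundaryIntegral_coordHalfSpace (t : ℝ) (g : E (N + 1) → ℝ) :
    boundaryIntegral (coordHalfSpace N t) g = ∫ y : E N, g (snocEquiv N (t, y)) := by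
  have hiso := isometry_snocEquiv_prodMk N t
  rw [boundaryIntegral, frontier_coordHalfSpace, ← range_snocEquiv_prodMk,
    ← hiso.map_euclideanHausdorffMeasure, hiso.isClosedEmbedding.measurableEmbedding.integral_map,
    EuclideanSpace.euclideanHausdorffMeasure_eq_volume]

end CoordHalfSpace

section Stability

variable {N : ℕ} {v : ℝ → ℝ} {μ : Measure ℝ} {t : ℝ}

theorem boundaryIntegral_exp_logDensity_mul (hv : Measurable v)
    (hμ : μ = volume.withDensity fun x => ENNReal.ofReal (Real.exp (-v x))) (t : ℝ)
    (g : E (N + 1) → ℝ) :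
    boundaryIntegral (coordHalfSpace N t) (fun x => Real.exp (logDensity v (N + 1) x) * g x) =
      Real.exp (-v t) * ∫ y, g (snocEquiv N (t, y)) ∂productMeasure μ N := by
  rw [boundaryIntegral_coordHalfSpace, hμ, productMeasure_withDensity_exp_neg hv,
    integral_withDensity_exp (by fun_prop), ← integral_const_mul]
  simp only [logDensity_snocEquiv, Real.exp_add, mul_assoc, mul_comm (Real.exp (logDensity _ _ _))]

theorem genMeanCurv_coordHalfSpace (hv : Differentiable ℝ v) (t : ℝ) (x : E (N + 1)) :
    genMeanCurv (logDensity v (N + 1)) (heightFunction (lastVector N) t) x =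
      deriv v (x (Fin.last N)) := by
  rw [genMeanCurv, sumCurv, shapeOperator_heightFunction, unitNormal_heightFunction norm_lastVector,
    inner_gradient_left, fderiv_logDensity hv]
  simp [lastVector, Fin.sum_univ_castSucc]

theorem indexForm_coordHalfSpace (hv : ContDiff ℝ 2 v)
    (hμ : μ = volume.withDensity fun x => ENNReal.ofReal (Real.exp (-v x))) (t : ℝ)
    {u : E (N + 1) → ℝ} (hu : Differentiable ℝ u) :
    indexForm (logDensity v (N + 1)) (heightFunction (lastVector N) t) (coordHalfSpace N t) u =
      Real.exp (-v t) *
        ((∫ y, ‖fderiv ℝ (fun z => u (snocEquiv N (t, z))) y‖ ^ 2 ∂productMeasure μ N) -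
          deriv (deriv v) t * ∫ y, u (snocEquiv N (t, y)) ^ 2 ∂productMeasure μ N) := by
  have hessian (y : E N) : fderiv ℝ (fderiv ℝ (logDensity v (N + 1))) (snocEquiv N (t, y))
      (lastVector N) (lastVector N) = -deriv (deriv v) t := by
    simp [fderiv_fderiv_logDensity hv, lastVector, Fin.sum_univ_castSucc]
  have hv' := hv.continuous.measurable
  simp only [indexForm, mul_assoc, boundaryIntegral_exp_logDensity_mul hv' hμ,
    unitNormal_heightFunction norm_lastVector, hessian, integral_mul_const,
    norm_tangentialGradient_heightFunction hu.differentiableAt, sumSqCurv,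
    shapeOperator_heightFunction, ContinuousLinearMap.comp_zero,
    ContinuousLinearMap.toLinearMap_zero, map_zero, zero_mul, sub_zero]
  ring

theorem isStable_coordHalfSpace (hv : ContDiff ℝ 2 v)
    (hμ : μ = volume.withDensity fun x => ENNReal.ofReal (Real.exp (-v x)))
    (ht : PoincareInequality (productMeasure μ N) (deriv (deriv v) t)) :
    IsStable (productMeasure μ (N + 1)) (coordHalfSpace N t) := by
  refine ⟨logDensity v (N + 1), heightFunction (lastVector N) t,
    hasLogDensity_productMeasure hv hμ _,
    coordHalfSpace_eq N t ▸ isDefiningFunction_heightFunction lastVector_ne_zero t,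
    ⟨deriv v t, fun x hx => ?_⟩, fun u hu hs mean_zero => ?_⟩
  · rw [frontier_coordHalfSpace] at hx
    rw [genMeanCurv_coordHalfSpace (hv.differentiable two_ne_zero), hx]
  · have slice_contDiff : ContDiff ℝ 1 fun y => u (snocEquiv N (t, y)) :=
      (hu.of_le (by simp)).comp ((snocEquiv N).contDiff.comp (by fun_prop))
    have slice_compact : HasCompactSupport fun y => u (snocEquiv N (t, y)) :=
      hs.comp_isClosedEmbedding (isometry_snocEquiv_prodMk N t).isClosedEmbedding
    have slice_mean_zero : ∫ y, u (snocEquiv N (t, y)) ∂productMeasure μ N = 0 := by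
      simp only [mul_comm (u _),
        boundaryIntegral_exp_logDensity_mul hv.continuous.measurable hμ] at mean_zero
      exact (mul_eq_zero.1 mean_zero).resolve_left (Real.exp_ne_zero _)
    have poincare := ht _ slice_contDiff slice_compact
    rw [variance_of_integral_eq_zero slice_contDiff.continuous.aemeasurable slice_mean_zero]
      at poincare
    rw [indexForm_coordHalfSpace hv hμ t (hu.differentiable (by simp))]
    exact mul_nonneg (Real.exp_nonneg _) (sub_nonneg.2 poincare)

end Stability

end HalfSpaceStability

theorem proposition3p5 (N : ℕ) (v : ℝ → ℝ) (hv : ContDiff ℝ 2 v)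
    (μ : MeasureTheory.Measure ℝ) [MeasureTheory.IsProbabilityMeasure μ]
    (hμ : μ = MeasureTheory.volume.withDensity fun x => ENNReal.ofReal (Real.exp (-v x))) :
    ∃ t : ℝ, HalfSpaceStability.IsStable (HalfSpaceStability.productMeasure μ (N + 1))
      (HalfSpaceStability.coordHalfSpace N t) := by
  obtain ⟨t, ht⟩ := HalfSpaceStability.exists_poincareInequality_deriv_deriv hv hμ
  exact ⟨t, HalfSpaceStability.isStable_coordHalfSpace hv hμ (ht.productMeasure N)⟩
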